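/- Let $0<\alpha<\tfrac12$. Let $Z=(Z_j)_{j\ge 0}$, $Z_j=(X_j,Y_j)$, be the nearest-neighbour Markov chain on $\mathbb{Z}_+^2=\{0,1,2,\dots\}^2$ started at $Z_0=(1,1)$ with the following transition probabilities: - from $(x,y)$ with $x,y\ge 1$, it moves to each of $(x\pm1,y)$, $(x,y\pm1)$ with probability $\tfrac14$; - for $i\ge 1$, from $(i,0)$ it moves to $(i,1)$ with probability $\frac{1}{2i^{\alpha}}$ and to $(i+1,0)$ with probability $1-\frac1{2i^\alpha}$; - for $i\ge 1$, from $(0,i)$ it moves to $(1,i)$ with probability $\frac{1}{2i^{\alpha}}$ and to $(0,i+1)$ with probability $1-\frac1{2i^\alpha}$; - from $(0,0)$ it moves to $(1,0)$ or $(0,1)$, each with probability $\tfrac12$. Then for every $0<\varepsilon<1$, $$\lim_{n\to\infty}\mathbb{P}\Big(\big\{X_j\neq 0\ \text{ for all integers } j\in[n^{1-\varepsilon},n]\big\}\cup\big\{Y_j\neq 0\ \text{ for all integers } j\in[n^{1-\varepsilon},n]\big\}\Big)=1 .$$ -/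

import Mathlib

open MeasureTheory Filter Topology

/-- Transition probabilities of the axis-driven nearest-neighbour walk on the quadrant `ℤ₊²`
with parameter `α`: simple random walk when both coordinates are positive; on an axis at distance
`i > 0` from the origin the walk enters the interior with probability `1 / (2 i ^ α)` and otherwise
moves one step away from the origin; from the origin it moves to `(1, 0)` or `(0, 1)`, each with
probability `1 / 2`. -/
noncomputable def axisWalkProb (α : ℝ) : ℕ × ℕ → ℕ × ℕ → ℝ
  | (0, 0), w => if w = (1, 0) ∨ w = (0, 1) then 1 / 2 else 0
  | (i + 1, 0), w =>
      if w = (i + 1, 1) then 1 / (2 * ((i + 1 : ℕ) : ℝ) ^ α)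
      else if w = (i + 2, 0) then 1 - 1 / (2 * ((i + 1 : ℕ) : ℝ) ^ α)
      else 0
  | (0, i + 1), w =>
      if w = (1, i + 1) then 1 / (2 * ((i + 1 : ℕ) : ℝ) ^ α)
      else if w = (0, i + 2) then 1 - 1 / (2 * ((i + 1 : ℕ) : ℝ) ^ α)
      else 0
  | (i + 1, j + 1), w =>
      if w = (i + 2, j + 1) ∨ w = (i, j + 1) ∨ w = (i + 1, j + 2) ∨ w = (i + 1, j) then 1 / 4
      else 0

/-- `Z = (X, Y)` is, under the probability `P`, a Markov chain on the quadrant with transition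
probabilities `axisWalkProb α`, started at `(1, 1)`. -/
structure IsAxisWalk (α : ℝ) {Ω : Type*} [MeasurableSpace Ω] (P : Measure Ω)
    (Z : ℕ → Ω → ℕ × ℕ) : Prop where
  isProbabilityMeasure : IsProbabilityMeasure P
  measurable : ∀ n, Measurable (Z n)
  start : ∀ᵐ ω ∂P, Z 0 ω = (1, 1)
  markov : ∀ (n : ℕ) (z : ℕ → ℕ × ℕ),
    P.real {ω | ∀ k ≤ n + 1, Z k ω = z k} =
      P.real {ω | ∀ k ≤ n, Z k ω = z k} * axisWalkProb α (z n) (z (n + 1))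

/-! Almost surely one of the axes is visited only finitely often. This suffices, since `n ^ (1 - ε)`
tends to infinity. The main point is a uniform bound `r < 1` on the probability of ever reaching the
second axis from a point `(x, 0)`, `x ≥ 1`. It comes from a nonnegative function, superharmonic off
the second axis and at least `1` on it (`exists_superharmonic`). At `(m, 0)` this function is at
most the tail of `∑ 8 / j ^ (1 + α)`: the walk leaves the first axis near `m` with probability of
order `m ^ (-α)`, and from height `1` it escapes a box of size about `m` before returning with
probability of order `1 / m`. Summability makes this small for large `m`; small `m` is handled by a
separate correction. Infinitely many visits to both axes would require arbitrarily many passages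
from the first axis to the second, each costing a factor `r`, so that event is null
(`measure_both_axes_infinitely_often`). -/

open scoped ENNReal

/-! ### Superharmonic barrier built from boxes along the first axis. -/

/-- The tail sums `∑ j ≥ m, 8 / j ^ (1 + α)`. -/
noncomputable def powTail (α : ℝ) (m : ℕ) : ℝ := ∑' j : ℕ, 8 * (1 / ((j + m : ℕ) : ℝ) ^ (1 + α))

lemma summable_powTail {α : ℝ} (hα : 0 < α) (m : ℕ) :
    Summable fun j : ℕ => 8 * (1 / ((j + m : ℕ) : ℝ) ^ (1 + α)) :=
  ((summable_nat_add_iff m).2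
    (Real.summable_one_div_nat_rpow.2 (by linarith : 1 < 1 + α))).mul_left 8

lemma powTail_nonneg (α : ℝ) (m : ℕ) : 0 ≤ powTail α m :=
  tsum_nonneg fun _ => by positivity

lemma powTail_succ {α : ℝ} (hα : 0 < α) (m : ℕ) :
    powTail α m = 8 * (1 / (m : ℝ) ^ (1 + α)) + powTail α (m + 1) := by
  unfold powTail
  rw [(summable_powTail hα m).tsum_eq_zero_add]
  simp only [zero_add, add_assoc, add_comm 1 m]

lemma tendsto_powTail (α : ℝ) : Tendsto (powTail α) atTop (𝓝 0) :=
  tendsto_sum_nat_add fun j : ℕ => 8 * (1 / (j : ℝ) ^ (1 + α))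

/-- The discrete harmonic polynomial centred at `(m, 0)`, normalized to be at least `1` on the sides
and the top of a box of half-width and height `m / 2 + 1`. -/
noncomputable def boxPoly (α : ℝ) (m : ℕ) (z : ℕ × ℕ) : ℝ :=
  powTail α m + (((z.1 : ℝ) - m) ^ 2 - (z.2 : ℝ) ^ 2 + 2 * ((m / 2 + 1 : ℕ) : ℝ) * z.2) /
    ((m / 2 + 1 : ℕ) : ℝ) ^ 2

/-- The function `boxPoly` inside its box, and `1` outside. -/
noncomputable def boxBarrier (α : ℝ) (m : ℕ) (z : ℕ × ℕ) : ℝ :=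
  if 1 ≤ z.1 ∧ z.1 < m + (m / 2 + 1) ∧ m < z.1 + (m / 2 + 1) ∧ z.2 < m / 2 + 1
  then boxPoly α m z else 1

/-- The lower envelope of the functions `boxBarrier`. -/
noncomputable def barrier (α : ℝ) (z : ℕ × ℕ) : ℝ := ⨅ m, boxBarrier α m z

lemma boxBarrier_nonneg (α : ℝ) (m : ℕ) (z : ℕ × ℕ) : 0 ≤ boxBarrier α m z := by
  unfold boxBarrier
  split_ifs with h
  · have hy : (z.2 : ℝ) ≤ ((m / 2 + 1 : ℕ) : ℝ) := by exact_mod_cast h.2.2.2.le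
    have hy0 : (0 : ℝ) ≤ z.2 := by positivity
    refine add_nonneg (powTail_nonneg α m) (div_nonneg ?_ (by positivity))
    nlinarith [sq_nonneg ((z.1 : ℝ) - m)]
  · exact zero_le_one

lemma barrier_le_boxBarrier (α : ℝ) (m : ℕ) (z : ℕ × ℕ) : barrier α z ≤ boxBarrier α m z :=
  ciInf_le ⟨0, by rintro _ ⟨k, rfl⟩; exact boxBarrier_nonneg α k z⟩ m

lemma barrier_nonneg (α : ℝ) (z : ℕ × ℕ) : 0 ≤ barrier α z :=
  le_ciInf fun m => boxBarrier_nonneg α m z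

lemma barrier_le_one (α : ℝ) (z : ℕ × ℕ) : barrier α z ≤ 1 := by
  -- The box of index `0` is empty: it would need `1 ≤ z.1 < 1`.
  refine (barrier_le_boxBarrier α 0 z).trans_eq (if_neg ?_)
  omega

lemma barrier_eq_one (α : ℝ) (y : ℕ) : barrier α (0, y) = 1 := by
  have : ∀ m, boxBarrier α m (0, y) = 1 := fun m => if_neg (by simp)
  simp [barrier, this]

/-- On the sides and top of the box the polynomial is already at least `1`, so the bound extends to
the closed box. It therefore applies at every neighbour of a point inside, which is what the
superharmonicity proofs need. -/
lemma barrier_le_boxPoly (α : ℝ) {m : ℕ} (hm : 1 ≤ m) {z : ℕ × ℕ}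
    (h₁ : z.1 ≤ m + (m / 2 + 1)) (h₂ : m ≤ z.1 + (m / 2 + 1)) (h₃ : z.2 ≤ m / 2 + 1) :
    barrier α z ≤ boxPoly α m z := by
  by_cases h : 1 ≤ z.1 ∧ z.1 < m + (m / 2 + 1) ∧ m < z.1 + (m / 2 + 1) ∧ z.2 < m / 2 + 1
  · exact (barrier_le_boxBarrier α m z).trans_eq (if_pos h)
  · refine (barrier_le_one α z).trans ?_
    have hy : (z.2 : ℝ) ≤ ((m / 2 + 1 : ℕ) : ℝ) := by exact_mod_cast h₃
    have hy0 : (0 : ℝ) ≤ z.2 := by positivity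
    have hu := powTail_nonneg α m
    have hL : (0 : ℝ) < ((m / 2 + 1 : ℕ) : ℝ) := by positivity
    have hb : z.1 = m + (m / 2 + 1) ∨ m = z.1 + (m / 2 + 1) ∨ z.2 = m / 2 + 1 := by omega
    have key : ((m / 2 + 1 : ℕ) : ℝ) ^ 2 ≤
        ((z.1 : ℝ) - m) ^ 2 - (z.2 : ℝ) ^ 2 + 2 * ((m / 2 + 1 : ℕ) : ℝ) * z.2 := by
      generalize m / 2 + 1 = l at *
      rcases hb with hb | hb | hb
      · have : (z.1 : ℝ) = m + l := by exact_mod_cast hb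
        nlinarith
      · have : (m : ℝ) = z.1 + l := by exact_mod_cast hb
        nlinarith
      · have : (z.2 : ℝ) = l := by exact_mod_cast hb
        nlinarith [sq_nonneg ((z.1 : ℝ) - m)]
    have := (one_le_div (by positivity : (0 : ℝ) < ((m / 2 + 1 : ℕ) : ℝ) ^ 2)).2 key
    unfold boxPoly
    linarith

lemma barrier_axis_le (α : ℝ) {x : ℕ} (hx : 1 ≤ x) : barrier α (x, 0) ≤ powTail α x := by
  refine (barrier_le_boxPoly α (m := x) hx (by simp) (by simp) (by simp)).trans_eq ?_
  simp [boxPoly]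

lemma barrier_superharmonic_interior (α : ℝ) (i j : ℕ) :
    1 / 4 * barrier α (i + 2, j + 1) + 1 / 4 * barrier α (i, j + 1) +
      1 / 4 * barrier α (i + 1, j + 2) + 1 / 4 * barrier α (i + 1, j) ≤
    barrier α (i + 1, j + 1) := by
  refine le_ciInf fun m => ?_
  unfold boxBarrier
  split_ifs with h
  · simp only at h
    -- Both `x ^ 2 - y ^ 2` and `y` are discrete harmonic.
    have e : boxPoly α m (i + 1, j + 1) =
        1 / 4 * boxPoly α m (i + 2, j + 1) + 1 / 4 * boxPoly α m (i, j + 1) +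
        1 / 4 * boxPoly α m (i + 1, j + 2) + 1 / 4 * boxPoly α m (i + 1, j) := by
      simp only [boxPoly]
      generalize m / 2 + 1 = l at *
      push_cast
      ring
    rw [e]
    have hm : 1 ≤ m := by omega
    gcongr <;> apply barrier_le_boxPoly α hm <;> simp only <;> omega
  · have := barrier_le_one α
    linarith [this (i + 2, j + 1), this (i, j + 1), this (i + 1, j + 2), this (i + 1, j)]

lemma half_pow_bounds {α : ℝ} (hα : 0 < α) (i : ℕ) :
    0 < 1 / (2 * ((i + 1 : ℕ) : ℝ) ^ α) ∧ 1 / (2 * ((i + 1 : ℕ) : ℝ) ^ α) ≤ 1 / 2 := by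
  have h : 1 ≤ ((i + 1 : ℕ) : ℝ) ^ α := Real.one_le_rpow (by simp) hα.le
  exact ⟨by positivity, one_div_le_one_div_of_le two_pos (by linarith)⟩

/-- With `x, l ≥ m / 2`, the constant `8` absorbs the two factors of `2`, one of them through `2 ^ α
≤ 2`. -/
lemma four_mul_half_pow_div_le {α : ℝ} (hα₀ : 0 < α) (hα₁ : α < 1 / 2) {x m l : ℕ} (hm : 1 ≤ m)
    (hx : m ≤ 2 * x) (hl : m ≤ 2 * l) :
    4 * (1 / (2 * (x : ℝ) ^ α)) / l ≤ 8 * (1 / (m : ℝ) ^ (1 + α)) := by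
  have hm0 : (0 : ℝ) < m := by exact_mod_cast hm
  have hx0 : (0 : ℝ) < x := by exact_mod_cast (by omega : 0 < x)
  have hl0 : (0 : ℝ) < l := by exact_mod_cast (by omega : 0 < l)
  have hl' : (m : ℝ) ≤ 2 * l := by exact_mod_cast hl
  have h1 : (m : ℝ) ^ α ≤ 2 * (x : ℝ) ^ α :=
    calc (m : ℝ) ^ α ≤ (2 * x : ℝ) ^ α :=
          Real.rpow_le_rpow hm0.le (by exact_mod_cast hx) hα₀.le
      _ = 2 ^ α * (x : ℝ) ^ α := Real.mul_rpow two_pos.le hx0.le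
      _ ≤ 2 * (x : ℝ) ^ α := by
          gcongr
          exact (Real.rpow_le_rpow_of_exponent_le one_le_two (by linarith)).trans_eq
            (Real.rpow_one 2)
  rw [Real.rpow_add hm0, Real.rpow_one]
  have ha : (0 : ℝ) < (m : ℝ) ^ α := by positivity
  have hb : (0 : ℝ) < (x : ℝ) ^ α := by positivity
  have h2 : (m : ℝ) * (m : ℝ) ^ α ≤ 2 * l * (2 * (x : ℝ) ^ α) := by gcongr
  calc 4 * (1 / (2 * (x : ℝ) ^ α)) / l = 8 * (1 / (2 * l * (2 * (x : ℝ) ^ α))) := by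
        field_simp; norm_num
    _ ≤ _ := by gcongr

/-- Stepping up costs at most `2 / L` within the same box. Stepping right is compared with the box
of index `m + 1`: the offset from the centre is unchanged and the tail loses its first term `S`.
Since `4 * p / L ≤ S` and `1 - p ≥ 1 / 2`, the gain covers the cost. -/
lemma barrier_superharmonic_axis {α : ℝ} (hα₀ : 0 < α) (hα₁ : α < 1 / 2) (i : ℕ) :
    1 / (2 * ((i + 1 : ℕ) : ℝ) ^ α) * barrier α (i + 1, 1) +
      (1 - 1 / (2 * ((i + 1 : ℕ) : ℝ) ^ α)) * barrier α (i + 2, 0) ≤ barrier α (i + 1, 0) := by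
  obtain ⟨hp0, hp1⟩ := half_pow_bounds hα₀ i
  refine le_ciInf fun m => ?_
  unfold boxBarrier
  split_ifs with h
  · simp only at h
    have hm : 1 ≤ m := by omega
    have hs := four_mul_half_pow_div_le hα₀ hα₁ (x := i + 1) (l := m / 2 + 1) hm
      (by omega) (by omega)
    set p := 1 / (2 * ((i + 1 : ℕ) : ℝ) ^ α)
    have h1 : barrier α (i + 1, 1) ≤ boxPoly α m (i + 1, 0) + 2 / ((m / 2 + 1 : ℕ) : ℝ) := by
      refine (barrier_le_boxPoly α hm (by simp only; omega) (by simp only; omega)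
        (by simp)).trans ?_
      simp only [boxPoly]
      have hL : (0 : ℝ) < ((m / 2 + 1 : ℕ) : ℝ) := by positivity
      generalize m / 2 + 1 = l at *
      have : 2 / (l : ℝ) = 2 * l / l ^ 2 := by field_simp
      rw [add_assoc, this, ← add_div]
      gcongr _ + ?_ / _
      push_cast
      linarith
    have h2 : barrier α (i + 2, 0) ≤
        boxPoly α m (i + 1, 0) - 8 * (1 / (m : ℝ) ^ (1 + α)) := by
      refine (barrier_le_boxPoly α (m := m + 1) (by omega) (by simp only; omega)
        (by simp only; omega) (by simp)).trans ?_
      simp only [boxPoly]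
      rw [powTail_succ hα₀ m]
      have : (((i + 1 : ℕ) : ℝ) - m) ^ 2 / (((m + 1) / 2 + 1 : ℕ) : ℝ) ^ 2 ≤
          (((i + 1 : ℕ) : ℝ) - m) ^ 2 / ((m / 2 + 1 : ℕ) : ℝ) ^ 2 := by
        gcongr
        omega
      push_cast at this ⊢
      ring_nf at this ⊢
      linarith
    set S := 8 * (1 / (m : ℝ) ^ (1 + α))
    have hS : 0 ≤ S := by positivity
    calc _ ≤ p * (boxPoly α m (i + 1, 0) + 2 / ((m / 2 + 1 : ℕ) : ℝ)) +
          (1 - p) * (boxPoly α m (i + 1, 0) - S) := by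
            gcongr
            linarith
      _ = boxPoly α m (i + 1, 0) + (4 * p / ((m / 2 + 1 : ℕ) : ℝ)) / 2 - (1 - p) * S := by ring
      _ ≤ _ := by nlinarith
  · have := barrier_le_one α
    nlinarith [this (i + 1, 1), this (i + 2, 0)]

/-- There is a nonnegative function, superharmonic off the second axis, at least `1` on that axis
and bounded away from `1` on the first axis. -/
lemma exists_superharmonic {α : ℝ} (hα₀ : 0 < α) (hα₁ : α < 1 / 2) :
    ∃ (V : ℕ × ℕ → ℝ) (r : ℝ), r < 1 ∧ (∀ z, 0 ≤ V z) ∧ (∀ y, 1 ≤ V (0, y)) ∧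
      (∀ x, V (x + 1, 0) ≤ r) ∧
      (∀ i j, 1 / 4 * V (i + 2, j + 1) + 1 / 4 * V (i, j + 1) + 1 / 4 * V (i + 1, j + 2) +
        1 / 4 * V (i + 1, j) ≤ V (i + 1, j + 1)) ∧
      ∀ i, 1 / (2 * ((i + 1 : ℕ) : ℝ) ^ α) * V (i + 1, 1) +
        (1 - 1 / (2 * ((i + 1 : ℕ) : ℝ) ^ α)) * V (i + 2, 0) ≤ V (i + 1, 0) := by
  obtain ⟨N, hN⟩ := eventually_atTop.1
    ((tendsto_powTail α).eventually (ge_mem_nhds (show (0 : ℝ) < 1 / 2 by norm_num)))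
  -- Near the origin the barrier may equal `1` on the axis, so it is capped there by `1 - e x`. The
  -- deficit `e` doubles at each step until it reaches `1 / 2` at `N`, where the barrier itself is
  -- at most `1 / 2`.
  let e : ℕ → ℝ := fun x => if N ≤ x then 1 / 2 else 2 ^ x / 2 ^ (N + 1)
  have he_le : ∀ x, e x ≤ 1 / 2 := by
    intro x
    simp only [e]
    split_ifs with h
    · exact le_rfl
    · rw [div_le_div_iff₀ (by positivity) two_pos, one_mul, ← pow_succ]
      exact pow_le_pow_right₀ one_le_two (by omega)
  have he_ge : ∀ x, 1 / 2 ^ (N + 1) ≤ e x := by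
    intro x
    simp only [e]
    split_ifs with h
    · apply one_div_le_one_div_of_le two_pos
      exact le_self_pow₀ one_le_two (by omega)
    · gcongr
      exact one_le_pow₀ one_le_two
  have he_succ : ∀ x < N, e (x + 1) = 2 * e x := by
    intro x hx
    simp only [e, if_neg (not_le.2 hx)]
    split_ifs with h
    · obtain rfl : N = x + 1 := by omega
      rw [pow_succ _ (x + 1), pow_succ]
      field_simp
    · ring
  let V : ℕ × ℕ → ℝ := fun z =>
    if z.1 ≠ 0 ∧ z.2 = 0 then min (barrier α z) (1 - e z.1) else barrier α z
  have hVle : ∀ z, V z ≤ barrier α z := by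
    intro z
    simp only [V]
    split_ifs
    · exact min_le_left _ _
    · exact le_rfl
  have hVaxis : ∀ x, V (x + 1, 0) = min (barrier α (x + 1, 0)) (1 - e (x + 1)) := by
    intro x
    simp [V]
  refine ⟨V, 1 - 1 / 2 ^ (N + 1), by simp, fun z => ?_, fun y => ?_, fun x => ?_, fun i j => ?_,
    fun i => ?_⟩
  · simp only [V]
    split_ifs
    · exact le_min (barrier_nonneg α z) (by linarith [he_le z.1])
    · exact barrier_nonneg α z
  · simp [V, barrier_eq_one]
  · rw [hVaxis]
    exact (min_le_right _ _).trans (by linarith [he_ge (x + 1)])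
  · have : V (i + 1, j + 1) = barrier α (i + 1, j + 1) := by simp [V]
    rw [this]
    refine le_trans ?_ (barrier_superharmonic_interior α i j)
    gcongr <;> apply hVle
  · obtain ⟨hp0, hp1⟩ := half_pow_bounds hα₀ i
    have hb := barrier_superharmonic_axis hα₀ hα₁ i
    set p := 1 / (2 * ((i + 1 : ℕ) : ℝ) ^ α)
    have hp2 : 0 ≤ 1 - p := by linarith
    have h1 : p * V (i + 1, 1) + (1 - p) * V (i + 2, 0) ≤ barrier α (i + 1, 0) := by
      refine le_trans ?_ hb
      gcongr <;> apply hVle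
    rw [hVaxis i]
    refine le_min h1 ?_
    by_cases hi : N ≤ i + 1
    · refine h1.trans ((barrier_axis_le α (by omega)).trans ((hN _ hi).trans ?_))
      linarith [he_le (i + 1)]
    -- The walk stays on the axis with probability at least `1 / 2`, so doubling the deficit there
    -- preserves it on average: `p + (1 - p) * (1 - 2 * e) ≤ 1 - e`.
    · have h2 : V (i + 2, 0) ≤ 1 - 2 * e (i + 1) := by
        rw [hVaxis (i + 1), ← he_succ (i + 1) (by omega)]
        exact min_le_right _ _
      have h3 : V (i + 1, 1) ≤ 1 := (hVle _).trans (barrier_le_one α _)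
      have h4 : 0 ≤ e (i + 1) := le_trans (by positivity) (he_ge (i + 1))
      nlinarith

/-! ### Events of the past and first-passage decomposition. -/

/-- The event `E` is determined by `Z 0, …, Z n`. -/
def DependsUpTo {Ω S : Type*} (Z : ℕ → Ω → S) (n : ℕ) (E : Set Ω) : Prop :=
  ∀ ω ω', (∀ k ≤ n, Z k ω = Z k ω') → ω ∈ E → ω' ∈ E

namespace DependsUpTo

variable {Ω S : Type*} {Z : ℕ → Ω → S} {n : ℕ} {E F : Set Ω}

lemma mono {m : ℕ} (h : DependsUpTo Z n E) (hnm : n ≤ m) : DependsUpTo Z m E :=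
  fun ω ω' hω => h ω ω' fun k hk => hω k (hk.trans hnm)

lemma inter (h : DependsUpTo Z n E) (h' : DependsUpTo Z n F) : DependsUpTo Z n (E ∩ F) :=
  fun ω ω' hω hE => ⟨h ω ω' hω hE.1, h' ω ω' hω hE.2⟩

lemma compl (h : DependsUpTo Z n E) : DependsUpTo Z n Eᶜ :=
  fun ω ω' hω hE hE' => hE (h ω' ω (fun k hk => (hω k hk).symm) hE')

lemma univ : DependsUpTo Z n (Set.univ : Set Ω) := fun _ _ _ _ => trivial

lemma preimage (s : Set S) : DependsUpTo Z n (Z n ⁻¹' s) := fun ω ω' hω hE => by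
  rw [Set.mem_preimage, ← hω n le_rfl]
  exact hE

lemma measurableSet [MeasurableSpace Ω] [MeasurableSpace S] [Countable S]
    [MeasurableSingletonClass S] (hZ : ∀ n, Measurable (Z n)) (h : DependsUpTo Z n E) :
    MeasurableSet E := by
  let H : Ω → Fin (n + 1) → S := fun ω k => Z k ω
  have hH : Measurable H := measurable_pi_lambda _ fun k => hZ k
  have : E = H ⁻¹' (H '' E) := by
    refine (Set.subset_preimage_image H E).antisymm ?_
    rintro ω ⟨ω', hω', hH'⟩
    exact h ω' ω (fun k hk => congrFun hH' ⟨k, by omega⟩) hω'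
  rw [this]
  exact hH (Set.to_countable _).measurableSet

end DependsUpTo

/-- Decomposition according to the first time at which one of the events `A j` occurs. -/
lemma measure_inter_exists_le {Ω S : Type*} [MeasurableSpace Ω] [MeasurableSpace S] [Countable S]
    [MeasurableSingletonClass S] {Z : ℕ → Ω → S} (hZ : ∀ n, Measurable (Z n)) (P : Measure Ω)
    {n : ℕ} {E B : Set Ω} (hE : DependsUpTo Z n E) {A : ℕ → Set Ω}
    (hA : ∀ j, DependsUpTo Z j (A j)) {ρ : ℝ≥0∞}
    (h : ∀ j F, DependsUpTo Z j F → F ⊆ A j → P (F ∩ B) ≤ ρ * P F) :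
    P (E ∩ {ω | ∃ j, n ≤ j ∧ ω ∈ A j} ∩ B) ≤ ρ * P (E ∩ {ω | ∃ j, n ≤ j ∧ ω ∈ A j}) := by
  classical
  let F : ℕ → Set Ω := fun j => {ω | ω ∈ E ∧ n ≤ j ∧ ω ∈ A j ∧ ∀ i, n ≤ i → i < j → ω ∉ A i}
  have hF : ∀ j, DependsUpTo Z j (F j) := by
    rintro j ω ω' hω ⟨h1, h2, h3, h4⟩
    refine ⟨hE.mono h2 ω ω' hω h1, h2, hA j ω ω' hω h3, fun i hi hij => ?_⟩
    exact (hA i).compl.mono hij.le ω ω' hω (h4 i hi hij)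
  have hU : E ∩ {ω | ∃ j, n ≤ j ∧ ω ∈ A j} = ⋃ j, F j := by
    ext ω
    simp only [Set.mem_inter_iff, Set.mem_ofPred_eq, Set.mem_iUnion, F]
    constructor
    · rintro ⟨h1, h2⟩
      refine ⟨Nat.find h2, h1, (Nat.find_spec h2).1, (Nat.find_spec h2).2, fun i hi hij hiA => ?_⟩
      exact Nat.find_min h2 hij ⟨hi, hiA⟩
    · rintro ⟨j, h1, h2, h3, -⟩
      exact ⟨h1, j, h2, h3⟩
  have hd : Pairwise (Function.onFun Disjoint F) := by
    intro i j hij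
    refine Set.disjoint_left.2 fun ω hi hj => ?_
    rcases lt_or_gt_of_ne hij with hlt | hlt
    · exact hj.2.2.2 i hi.2.1 hlt hi.2.2.1
    · exact hi.2.2.2 j hj.2.1 hlt hj.2.2.1
  rw [hU, Set.iUnion_inter, measure_iUnion hd fun j => (hF j).measurableSet hZ,
    ← ENNReal.tsum_mul_left]
  exact (measure_iUnion_le _).trans
    (ENNReal.tsum_le_tsum fun j => h j _ (hF j) fun ω hω => hω.2.2.1)

/-! ### One-step estimates and hitting probabilities for the walk. -/

namespace IsAxisWalk

variable {α : ℝ} {Ω : Type*} [MeasurableSpace Ω] {P : Measure Ω} {Z : ℕ → Ω → ℕ × ℕ}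

lemma measure_cylinder_inter (hZ : IsAxisWalk α P Z) (n : ℕ) (z : ℕ → ℕ × ℕ) (w : ℕ × ℕ) :
    P ({ω | ∀ k ≤ n, Z k ω = z k} ∩ Z (n + 1) ⁻¹' {w}) =
      P {ω | ∀ k ≤ n, Z k ω = z k} * ENNReal.ofReal (axisWalkProb α (z n) w) := by
  have := hZ.isProbabilityMeasure
  have h := hZ.markov n (Function.update z (n + 1) w)
  have hu : ∀ k ≤ n, Function.update z (n + 1) w k = z k := fun k hk =>
    Function.update_of_ne (by omega) _ _
  have e1 : {ω | ∀ k ≤ n, Z k ω = Function.update z (n + 1) w k} =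
      {ω | ∀ k ≤ n, Z k ω = z k} := by
    ext ω
    exact forall₂_congr fun k hk => by rw [hu k hk]
  have e2 : {ω | ∀ k ≤ n + 1, Z k ω = Function.update z (n + 1) w k} =
      {ω | ∀ k ≤ n, Z k ω = z k} ∩ Z (n + 1) ⁻¹' {w} := by
    rw [← e1]
    ext ω
    constructor
    · intro hω
      exact ⟨fun k hk => hω k (by omega), by simpa using hω (n + 1) le_rfl⟩
    · rintro ⟨h1, h2⟩ k hk
      rcases Nat.le_succ_iff.1 hk with hk | rfl
      · exact h1 k hk
      · simpa using h2
  rw [e1, e2, hu n le_rfl, Function.update_self] at h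
  rw [← ofReal_measureReal (μ := P), h, ENNReal.ofReal_mul measureReal_nonneg, ofReal_measureReal]

/-- The supermartingale inequality on a past event, proved by cutting the event into countably many
cylinders. -/
lemma setLIntegral_succ_le (hZ : IsAxisWalk α P Z) {n : ℕ} {E : Set Ω} (hE : DependsUpTo Z n E)
    (V : ℕ × ℕ → ℝ≥0∞)
    (hV : ∀ ω ∈ E, ∑' w, ENNReal.ofReal (axisWalkProb α (Z n ω) w) * V w ≤ V (Z n ω)) :
    ∫⁻ ω in E, V (Z (n + 1) ω) ∂P ≤ ∫⁻ ω in E, V (Z n ω) ∂P := by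
  have hVm : Measurable V := measurable_of_countable V
  let F : (Fin (n + 1) → ℕ × ℕ) → Set Ω := fun f => {ω | ω ∈ E ∧ ∀ k : Fin (n + 1), Z k ω = f k}
  have hF : ∀ f, DependsUpTo Z n (F f) := by
    rintro f ω ω' hω ⟨h1, h2⟩
    exact ⟨hE ω ω' hω h1, fun k => by rw [← h2 k, hω k (by omega)]⟩
  have hU : E = ⋃ f, F f := by
    ext ω
    simp only [Set.mem_iUnion, F, Set.mem_ofPred_eq]
    exact ⟨fun h => ⟨fun k => Z k ω, h, fun _ => rfl⟩, fun ⟨_, h, _⟩ => h⟩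
  have hd : Pairwise (Function.onFun Disjoint F) := fun f g hfg =>
    Set.disjoint_left.2 fun ω hf hg => hfg (funext fun k => (hf.2 k).symm.trans (hg.2 k))
  have hm : ∀ f, MeasurableSet (F f) := fun f => (hF f).measurableSet hZ.measurable
  rw [hU, lintegral_iUnion hm hd, lintegral_iUnion hm hd]
  refine ENNReal.tsum_le_tsum fun f => ?_
  rcases (F f).eq_empty_or_nonempty with h0 | ⟨ω₀, h₀⟩
  · simp [h0]
  have hc : F f = {ω | ∀ k ≤ n, Z k ω = Z k ω₀} := by
    ext ω
    constructor
    · intro hω k hk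
      exact (hω.2 ⟨k, by omega⟩).trans (h₀.2 ⟨k, by omega⟩).symm
    · exact fun hω => hF f ω₀ ω (fun k hk => (hω k hk).symm) h₀
  have h1 : ∫⁻ ω in F f, V (Z n ω) ∂P = V (Z n ω₀) * P (F f) := by
    rw [← setLIntegral_const]
    refine setLIntegral_congr_fun (hm f) fun ω hω => ?_
    rw [hc] at hω
    simp only [hω n le_rfl]
  have h2 : ∫⁻ ω in F f, V (Z (n + 1) ω) ∂P =
      (∑' w, ENNReal.ofReal (axisWalkProb α (Z n ω₀) w) * V w) * P (F f) := by
    rw [← lintegral_map hVm (hZ.measurable (n + 1)), lintegral_countable', ← ENNReal.tsum_mul_right]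
    refine tsum_congr fun w => ?_
    have hw : MeasurableSet ({w} : Set (ℕ × ℕ)) := measurableSet_singleton w
    rw [Measure.map_apply (hZ.measurable (n + 1)) hw,
      Measure.restrict_apply (hZ.measurable (n + 1) hw), Set.inter_comm, hc,
      hZ.measure_cylinder_inter n (fun k => Z k ω₀) w]
    ring
  rw [h1, h2]
  gcongr
  exact hV ω₀ h₀.1

/-- No transition leads into the origin, the one point lying on both axes. -/
lemma ae_ne_origin (hZ : IsAxisWalk α P Z) : ∀ᵐ ω ∂P, ∀ n, Z n ω ≠ (0, 0) := by
  refine ae_all_iff.2 fun n => ?_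
  induction n with
  | zero => filter_upwards [hZ.start] with ω hω using by simp [hω]
  | succ n ih =>
    let V : ℕ × ℕ → ℝ≥0∞ := fun z => if z = (0, 0) then 1 else 0
    have hVm : Measurable V := measurable_of_countable V
    have hV0 : ∀ z, V z = 0 ↔ z ≠ (0, 0) := fun z => by simp [V]
    have h := hZ.setLIntegral_succ_le (n := n) DependsUpTo.univ V fun ω _ => by
      refine le_trans (le_of_eq ?_) (zero_le (a := V (Z n ω)))
      refine ENNReal.tsum_eq_zero.2 fun w => ?_
      by_cases hw : w = (0, 0)
      · have : ∀ z, axisWalkProb α z (0, 0) = 0 := by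
          rintro ⟨_ | i, _ | j⟩ <;> simp [axisWalkProb]
        simp [hw, this]
      · rw [(hV0 w).2 hw, mul_zero]
    simp only [Measure.restrict_univ] at h
    have h0 : ∫⁻ ω, V (Z n ω) ∂P = 0 := by
      refine (lintegral_eq_zero_iff (hVm.comp (hZ.measurable n))).2 ?_
      filter_upwards [ih] with ω hω using (hV0 _).2 hω
    have h1 := (lintegral_eq_zero_iff (hVm.comp (hZ.measurable (n + 1)))).1
      (nonpos_iff_eq_zero.1 (h.trans_eq h0))
    filter_upwards [h1] with ω hω using (hV0 _).1 hω

lemma measure_inter_hit_le (hZ : IsAxisWalk α P Z) {V : ℕ × ℕ → ℝ≥0∞} (hV1 : ∀ y, 1 ≤ V (0, y))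
    (hV : ∀ z : ℕ × ℕ, z.1 ≠ 0 → ∑' w, ENNReal.ofReal (axisWalkProb α z w) * V w ≤ V z)
    {n : ℕ} {E : Set Ω} (hE : DependsUpTo Z n E) :
    P (E ∩ {ω | ∃ j, n ≤ j ∧ (Z j ω).1 = 0}) ≤ ∫⁻ ω in E, V (Z n ω) ∂P := by
  have hz : ∀ n, DependsUpTo Z n {ω | (Z n ω).1 = 0} := fun n =>
    DependsUpTo.preimage (Z := Z) (n := n) {z : ℕ × ℕ | z.1 = 0}
  have hle : ∀ (n : ℕ) (E : Set Ω), DependsUpTo Z n E →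
      P (E ∩ {ω | (Z n ω).1 = 0}) ≤ ∫⁻ ω in E ∩ {ω | (Z n ω).1 = 0}, V (Z n ω) ∂P := by
    intro n E hE
    rw [← setLIntegral_one]
    refine setLIntegral_mono' ((hE.inter (hz n)).measurableSet hZ.measurable) fun ω hω => ?_
    rcases h : Z n ω with ⟨x, y⟩
    obtain rfl : x = 0 := by simpa [h] using hω.2
    exact hV1 y
  -- Finite-horizon optional stopping. Both `n` and `E` vary in the induction: the part of `E`
  -- already on the second axis is settled, the rest moves to time `n + 1`.
  have hfin : ∀ (N n : ℕ) (E : Set Ω), DependsUpTo Z n E →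
      P (E ∩ {ω | ∃ j, n ≤ j ∧ j ≤ n + N ∧ (Z j ω).1 = 0}) ≤ ∫⁻ ω in E, V (Z n ω) ∂P := by
    intro N
    induction N with
    | zero =>
      intro n E hE
      refine le_trans (measure_mono ?_) ((hle n E hE).trans
        (lintegral_mono_set Set.inter_subset_left))
      rintro ω ⟨h1, j, h2, h3, h4⟩
      obtain rfl : j = n := by omega
      exact ⟨h1, h4⟩
    | succ N ih =>
      intro n E hE
      have hE2 : DependsUpTo Z n (E ∩ {ω | (Z n ω).1 = 0}ᶜ) := hE.inter (hz n).compl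
      have h2 := (ih (n + 1) _ (hE2.mono n.le_succ)).trans
        (hZ.setLIntegral_succ_le hE2 V fun ω hω => hV _ hω.2)
      rw [← lintegral_inter_add_sdiff (μ := P) (fun ω => V (Z n ω)) E
        ((hz n).measurableSet hZ.measurable), Set.sdiff_eq]
      refine le_trans (measure_mono ?_) ((measure_union_le _ _).trans (add_le_add (hle n E hE) h2))
      rintro ω ⟨hω, j, hj1, hj2, hj3⟩
      by_cases h0 : (Z n ω).1 = 0
      · exact Or.inl ⟨hω, h0⟩
      · refine Or.inr ⟨⟨hω, h0⟩, j, ?_, by omega, hj3⟩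
        rcases hj1.eq_or_lt with rfl | hlt
        · exact absurd hj3 h0
        · exact hlt
  have hU : E ∩ {ω | ∃ j, n ≤ j ∧ (Z j ω).1 = 0} =
      ⋃ N, E ∩ {ω | ∃ j, n ≤ j ∧ j ≤ n + N ∧ (Z j ω).1 = 0} := by
    rw [← Set.inter_iUnion]
    congr 1
    ext ω
    simp only [Set.mem_ofPred_eq, Set.mem_iUnion]
    exact ⟨fun ⟨j, h1, h2⟩ => ⟨j, j, h1, by omega, h2⟩, fun ⟨_, j, h1, _, h2⟩ => ⟨j, h1, h2⟩⟩
  rw [hU, Monotone.measure_iUnion]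
  · exact iSup_le fun N => hfin N n E hE
  · rintro M N hMN ω ⟨h1, j, h2, h3, h4⟩
    exact ⟨h1, j, h2, by omega, h4⟩

lemma tsum_axisWalkProb_mul_le {V : ℕ × ℕ → ℝ} (hα₀ : 0 < α) (hV0 : ∀ z, 0 ≤ V z)
    (hVi : ∀ i j, 1 / 4 * V (i + 2, j + 1) + 1 / 4 * V (i, j + 1) + 1 / 4 * V (i + 1, j + 2) +
      1 / 4 * V (i + 1, j) ≤ V (i + 1, j + 1))
    (hVa : ∀ i, 1 / (2 * ((i + 1 : ℕ) : ℝ) ^ α) * V (i + 1, 1) +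
      (1 - 1 / (2 * ((i + 1 : ℕ) : ℝ) ^ α)) * V (i + 2, 0) ≤ V (i + 1, 0))
    {z : ℕ × ℕ} (hz : z.1 ≠ 0) :
    ∑' w, ENNReal.ofReal (axisWalkProb α z w) * ENNReal.ofReal (V w) ≤ ENNReal.ofReal (V z) := by
  obtain ⟨_ | i, _ | j⟩ := z
  · exact absurd rfl hz
  · exact absurd rfl hz
  · obtain ⟨hp0, hp1⟩ := half_pow_bounds hα₀ i
    refine le_trans (le_of_eq ?_) (ENNReal.ofReal_le_ofReal (hVa i))
    rw [tsum_eq_sum (s := {(i + 1, 1), (i + 2, 0)}), Finset.sum_pair (by simp),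
      ENNReal.ofReal_add (mul_nonneg hp0.le (hV0 _)) (mul_nonneg (by linarith) (hV0 _)),
      ENNReal.ofReal_mul hp0.le, ENNReal.ofReal_mul (by linarith)]
    · simp [axisWalkProb]
    · intro w hw
      simp only [Finset.mem_insert, Finset.mem_singleton, not_or] at hw
      simp [axisWalkProb, hw]
  · refine le_trans (le_of_eq ?_) (ENNReal.ofReal_le_ofReal (hVi i j))
    have h4 : (0 : ℝ) ≤ 1 / 4 := by norm_num
    have hp : ∀ z, 0 ≤ 1 / 4 * V z := fun z => mul_nonneg h4 (hV0 z)
    rw [tsum_eq_sum (s := {(i + 2, j + 1), (i, j + 1), (i + 1, j + 2), (i + 1, j)}),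
      Finset.sum_insert (by simp), Finset.sum_insert (by simp), Finset.sum_pair (by simp),
      ENNReal.ofReal_add (by linarith [hp (i + 2, j + 1), hp (i, j + 1), hp (i + 1, j + 2)]) (hp _),
      ENNReal.ofReal_add (by linarith [hp (i + 2, j + 1), hp (i, j + 1)]) (hp _),
      ENNReal.ofReal_add (hp _) (hp _)]
    · simp [axisWalkProb, ENNReal.ofReal_mul, add_assoc]
    · intro w hw
      simp only [Finset.mem_insert, Finset.mem_singleton, not_or] at hw
      simp [axisWalkProb, hw]

/-! ### Alternation between the axes, and the conclusion. -/

/-- Almost surely, one of the two axes is visited only finitely often. -/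
lemma measure_both_axes_infinitely_often (hZ : IsAxisWalk α P Z) (hα₀ : 0 < α) (hα₁ : α < 1 / 2) :
    P {ω | (∀ n, ∃ j, n ≤ j ∧ (Z j ω).1 = 0) ∧ ∀ n, ∃ j, n ≤ j ∧ (Z j ω).2 = 0} = 0 := by
  have := hZ.isProbabilityMeasure
  obtain ⟨V, r, hr, hV0, hV1, hVr, hVi, hVa⟩ := exists_superharmonic hα₀ hα₁
  set B := {ω | (∀ n, ∃ j, n ≤ j ∧ (Z j ω).1 = 0) ∧ ∀ n, ∃ j, n ≤ j ∧ (Z j ω).2 = 0}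
  have hhit : ∀ {n : ℕ} {E : Set Ω}, DependsUpTo Z n E → (∀ ω ∈ E, (Z n ω).1 ≠ 0 ∧ (Z n ω).2 = 0) →
      P (E ∩ {ω | ∃ j, n ≤ j ∧ (Z j ω).1 = 0}) ≤ ENNReal.ofReal r * P E := by
    intro n E hE hax
    refine (hZ.measure_inter_hit_le (V := fun z => ENNReal.ofReal (V z)) (fun y => ?_)
      (fun z => tsum_axisWalkProb_mul_le hα₀ hV0 hVi hVa) hE).trans ?_
    · exact ENNReal.one_le_ofReal.2 (hV1 y)
    · rw [← setLIntegral_const]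
      refine setLIntegral_mono' (hE.measurableSet hZ.measurable) fun ω hω => ?_
      obtain ⟨h1, h2⟩ := hax ω hω
      rcases h : Z n ω with ⟨x, y⟩
      simp only [h] at h1 h2
      subst h2
      obtain ⟨x, rfl⟩ := Nat.exists_eq_succ_of_ne_zero h1
      exact ENNReal.ofReal_le_ofReal (hVr x)
  let O := {ω | ∀ n, Z n ω ≠ (0, 0)}
  -- Each induction step waits for the next visit to the first axis, then for a visit to the second,
  -- which gives the factor `r`, and restarts from there. Off the origin, a visit to the first axis
  -- has nonzero first coordinate, as `hhit` requires.
  have hpow : ∀ (k n : ℕ) (E : Set Ω), DependsUpTo Z n E →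
      P (E ∩ (B ∩ O)) ≤ ENNReal.ofReal r ^ k * P E := by
    intro k
    induction k with
    | zero => intro n E _; simpa using measure_mono Set.inter_subset_left
    | succ k ih =>
      intro n E hE
      have h1 : ∀ j F, DependsUpTo Z j F → F ⊆ Z j ⁻¹' {z | z.1 ≠ 0 ∧ z.2 = 0} →
          P (F ∩ (B ∩ O)) ≤ ENNReal.ofReal r ^ (k + 1) * P F := by
        intro j F hF hFs
        have h2 := measure_inter_exists_le hZ.measurable P (B := B ∩ O) hF
          (A := fun l => Z l ⁻¹' {z | z.1 = 0}) (fun l => DependsUpTo.preimage _)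
          (fun l G hG _ => ih l G hG)
        refine le_trans (measure_mono ?_) (h2.trans ?_)
        · exact fun ω hω => ⟨⟨hω.1, hω.2.1.1 j⟩, hω.2⟩
        · rw [pow_succ, mul_assoc]
          gcongr
          exact hhit hF hFs
      have h3 := measure_inter_exists_le hZ.measurable P (B := B ∩ O) hE
          (A := fun l => Z l ⁻¹' {z | z.1 ≠ 0 ∧ z.2 = 0}) (fun l => DependsUpTo.preimage _) h1
      refine le_trans (measure_mono ?_) (h3.trans ?_)
      · rintro ω ⟨hω, hωB, hωO⟩
        obtain ⟨j, hj, hj'⟩ := hωB.2 n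
        exact ⟨⟨hω, j, hj, fun h => hωO j (Prod.ext h hj'), hj'⟩, hωB, hωO⟩
      · gcongr
        exact Set.inter_subset_left
  have hBO : P (B ∩ O) = 0 := by
    refine le_antisymm (ge_of_tendsto' (ENNReal.tendsto_pow_atTop_nhds_zero_of_lt_one
      (ENNReal.ofReal_lt_one.2 hr)) fun k => ?_) (zero_le (a := P (B ∩ O)))
    simpa using hpow k 0 Set.univ DependsUpTo.univ
  refine measure_mono_null (t := B ∩ O ∪ Oᶜ) (fun ω hω => ?_)
    (measure_union_null hBO (ae_iff.1 hZ.ae_ne_origin))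
  by_cases h : ω ∈ O
  · exact Or.inl ⟨hω, h⟩
  · exact Or.inr h

end IsAxisWalk

theorem mainTheorem9 (α : ℝ) (hα₀ : 0 < α) (hα₁ : α < 1 / 2)
    {Ω : Type*} [MeasurableSpace Ω] (P : Measure Ω) (Z : ℕ → Ω → ℕ × ℕ)
    (hZ : IsAxisWalk α P Z) (ε : ℝ) (hε₀ : 0 < ε) (hε₁ : ε < 1) :
    Tendsto
      (fun n : ℕ => P.real {ω |
        (∀ j : ℕ, (n : ℝ) ^ (1 - ε) ≤ (j : ℝ) → j ≤ n → (Z j ω).1 ≠ 0) ∨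
        (∀ j : ℕ, (n : ℝ) ^ (1 - ε) ≤ (j : ℝ) → j ≤ n → (Z j ω).2 ≠ 0)})
      atTop (𝓝 1) := by
  have := hZ.isProbabilityMeasure
  let G : ℕ → Set Ω := fun N =>
    {ω | (∀ j, N ≤ j → (Z j ω).1 ≠ 0) ∨ ∀ j, N ≤ j → (Z j ω).2 ≠ 0}
  have hGmono : Monotone G := fun M N hMN ω hω =>
    hω.imp (fun h j hj => h j (hMN.trans hj)) fun h j hj => h j (hMN.trans hj)
  have hGU : P.real (⋃ N, G N) = 1 := by
    have hae : ∀ᵐ ω ∂P, ω ∈ ⋃ N, G N := by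
      refine measure_mono_null (fun ω hω => ?_) (hZ.measure_both_axes_infinitely_often hα₀ hα₁)
      simp only [Set.mem_compl_iff, Set.mem_iUnion, Set.mem_ofPred_eq, G, not_exists, not_or,
        not_forall, not_not, exists_prop] at hω
      exact ⟨fun n => (hω n).1, fun n => (hω n).2⟩
    have h1 : P (⋃ N, G N) = P Set.univ := measure_congr (eventuallyEq_univ.2 hae)
    rw [measureReal_def, h1, measure_univ, ENNReal.toReal_one]
  have hlim : Tendsto (fun N => P.real (G N)) atTop (𝓝 1) := by
    rw [← hGU]
    exact (ENNReal.tendsto_toReal (measure_ne_top P _)).comp (tendsto_measure_iUnion_atTop hGmono)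
  have hpow : Tendsto (fun n : ℕ => ⌈(n : ℝ) ^ (1 - ε)⌉₊) atTop atTop :=
    tendsto_nat_ceil_atTop.comp
      ((tendsto_rpow_atTop (by linarith)).comp tendsto_natCast_atTop_atTop)
  refine tendsto_of_tendsto_of_tendsto_of_le_of_le (hlim.comp hpow) tendsto_const_nhds
    (fun n => measureReal_mono fun ω hω => ?_) fun n => measureReal_le_one
  exact hω.imp (fun h j hj _ => h j (Nat.ceil_le.2 hj)) fun h j hj _ => h j (Nat.ceil_le.2 hj)
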